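/- Let $X$ and $Y$ be real Banach spaces with $X$ reflexive, and let $Z$ be a closed subspace of $Y$. Write $S_X$ for the unit sphere of $X$, $E_X$ for the set of extreme points of the closed unit ball of $X$, $\mathcal{L}(X,Y)$ for the space of bounded linear operators with the operator norm, and $d(v,W)=\inf_{w\in W}\|v-w\|$. For a vector $v$ and a subspace $W$ of a real normed space, $v\perp_B W$ means that $\|v+\lambda w\|\ge\|v\|$ for all $w\in W$ and $\lambda\in\mathbb{R}$. Regard $Y$ as canonically embedded in $Y^{**}$, let $Z^\perp=\{y^*\in Y^*: y^*(z)=0\ \forall z\in Z\}$ and $Z^{\perp\perp}=\{u\in Y^{**}: u(y^*)=0\ \forall y^*\in Z^\perp\}$; regard $\mathcal{L}(X,Z)$ as a subspace of $\mathcal{L}(X,Y)$, and $\mathcal{L}(X,Y)$ and $\mathcal{L}(X,Z^{\perp\perp})$ as subspaces of $\mathcal{L}(X,Y^{**})$. Let $T\in\mathcal{L}(X,Y)$ be a non-zero compact operator that is multi-smooth of finite order, i.e. the linear span of $J(T)=\{f\in\mathcal{L}(X,Y)^*:\|f\|=1,\ f(T)=\|T\|\}$ is finite-dimensional. Let $M_T=\{x\in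 S_X:\|Tx\|=\|T\|\}$, and suppose that $M_T\cap E_X=\{\pm x_i:1\le i\le n\}$ with $x_1,\dots,x_n$ linearly independent, and that $T\perp_B\mathcal{L}(X,Z)$. Then there exists $x_0\in M_T\cap E_X$ such that (i) $d(T,\mathcal{L}(X,Z))=\sup_{x\in S_X}d(Tx,Z)=d(Tx_0,Z)$; (ii) $Tx_0\perp_B Z^{\perp\perp}$; (iii) $T\perp_B\mathcal{L}(X,Z^{\perp\perp})$. -/

import Mathlib

set_option maxSynthPendingDepth 3

namespace BJMinimax

/-- A real normed space is reflexive if the canonical embedding into its bidual is onto. -/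
def IsReflexive (X : Type*) [NormedAddCommGroup X] [NormedSpace ℝ X] : Prop :=
  Function.Surjective (NormedSpace.inclusionInDoubleDual ℝ X)

/-- Birkhoff-James orthogonality `x ⊥_B y`. -/
def BJOrth {E : Type*} [NormedAddCommGroup E] [NormedSpace ℝ E] (x y : E) : Prop :=
  ∀ c : ℝ, ‖x‖ ≤ ‖x + c • y‖

/-- `x ⊥_B W` for a subspace `W`. -/
def BJOrthTo {E : Type*} [NormedAddCommGroup E] [NormedSpace ℝ E]
    (x : E) (W : Submodule ℝ E) : Prop :=
  ∀ w ∈ W, BJOrth x w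

/-- `J(x)`: the norm-one functionals `f` with `f x = ‖x‖`. -/
def supportFunctionals {E : Type*} [NormedAddCommGroup E] [NormedSpace ℝ E] (x : E) :
    Set (StrongDual ℝ E) :=
  {f | ‖f‖ = 1 ∧ f x = ‖x‖}

/-- A nonzero `x` is multi-smooth of finite order if the span of `J(x)` is finite-dimensional.
For operators this is applied with `E = X →L[ℝ] Y`. -/
def IsMultiSmooth {E : Type*} [NormedAddCommGroup E] [NormedSpace ℝ E] (x : E) : Prop :=
  x ≠ 0 ∧ FiniteDimensional ℝ (Submodule.span ℝ (supportFunctionals x))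

/-- `M_T`: the unit vectors at which `T` attains its norm. -/
def normAttainment {X Y : Type*} [NormedAddCommGroup X] [NormedSpace ℝ X]
    [NormedAddCommGroup Y] [NormedSpace ℝ Y] (T : X →L[ℝ] Y) : Set X :=
  {x | ‖x‖ = 1 ∧ ‖T x‖ = ‖T‖}

/-- `E_X`: the extreme points of the closed unit ball. -/
def extremeBall (X : Type*) [NormedAddCommGroup X] [NormedSpace ℝ X] : Set X :=
  (Metric.closedBall (0 : X) 1).extremePoints ℝ

/-- `ℒ(X, Z)` as a subspace of `ℒ(X, Y)`: the bounded operators with range in `Z`. -/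
def operatorsInto (X : Type*) {Y : Type*} [NormedAddCommGroup X] [NormedSpace ℝ X]
    [NormedAddCommGroup Y] [NormedSpace ℝ Y] (Z : Submodule ℝ Y) :
    Submodule ℝ (X →L[ℝ] Y) where
  carrier := {S | ∀ x, S x ∈ Z}
  zero_mem' := fun _ => Z.zero_mem
  add_mem' := fun hS hR x => Z.add_mem (hS x) (hR x)
  smul_mem' := fun c _ hS x => Z.smul_mem c (hS x)

/-- The annihilator `W^⊥` in the dual space: the functionals that vanish on `W`. -/
def annihilator {E : Type*} [NormedAddCommGroup E] [NormedSpace ℝ E]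
    (W : Submodule ℝ E) : Submodule ℝ (StrongDual ℝ E) where
  carrier := {f | ∀ w ∈ W, f w = 0}
  zero_mem' := fun _ _ => rfl
  add_mem' := fun hf hg w hw => by simp [hf w hw, hg w hw]
  smul_mem' := fun c _ hf w hw => by simp [hf w hw]

/-- `Z^⊥⊥`, a subspace of the bidual. -/
noncomputable def biannihilator {Y : Type*} [NormedAddCommGroup Y] [NormedSpace ℝ Y]
    (Z : Submodule ℝ Y) : Submodule ℝ (StrongDual ℝ (StrongDual ℝ Y)) :=
  annihilator (annihilator Z)

/-- `T` regarded as an operator into the bidual of `Y`. -/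
noncomputable def toBidual {X Y : Type*} [NormedAddCommGroup X] [NormedSpace ℝ X]
    [NormedAddCommGroup Y] [NormedSpace ℝ Y] (T : X →L[ℝ] Y) :
    X →L[ℝ] StrongDual ℝ (StrongDual ℝ Y) :=
  (NormedSpace.inclusionInDoubleDual ℝ Y).comp T

end BJMinimax

open Filter Topology Set

namespace BJMinimax

/-! Everything follows from one norm-attaining extreme point `x₀` with `T x₀ ⊥_B Z`. If there were
none, each `x i` would have `z i ∈ Z` with `‖T (x i) + z i‖ < ‖T‖`, and linear independence would
give a finite-rank `S` into `Z` with `S (x i) = z i`. Since `T ⊥_B S`, compactness yields `a`, `b`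
in the unit balls with `b (T a) = ‖T‖` and `b (S a) ≥ 0` (`exists_norming_of_bjOrth`). Maximising `b
∘ T`, then `b ∘ S`, over the weakly compact ball replaces `a` by an extreme point, hence by some `±
x i`, where `± b` contradicts the strict inequality. Given `x₀`, Hahn-Banach in `Y ⧸ Z` provides a
functional in `Z^⊥` norming `T x₀`. Elements of `Z^⊥⊥` vanish at it, which gives (ii), and testing
operators at `x₀` gives (iii). -/

/-- Lexicographic maximisation over a compact set in a locally convex space is realised at an
extreme point. -/
theorem exists_extremePoint_of_isMaxOn {E : Type*} [AddCommGroup E] [Module ℝ E]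
    [TopologicalSpace E] [T2Space E] [IsTopologicalAddGroup E] [ContinuousSMul ℝ E]
    [LocallyConvexSpace ℝ E] {s : Set E} (hs : IsCompact s) (φ ψ : StrongDual ℝ E) {v : E}
    (hv : v ∈ s) (hmax : ∀ w ∈ s, φ w ≤ φ v) :
    ∃ e ∈ s.extremePoints ℝ, φ e = φ v ∧ ψ v ≤ ψ e := by
  have hF : IsExposed ℝ s {y ∈ s | ∀ z ∈ s, φ z ≤ φ y} := fun _ => ⟨φ, rfl⟩
  set F := {y ∈ s | ∀ z ∈ s, φ z ≤ φ y} with hFdef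
  have hvF : v ∈ F := ⟨hv, hmax⟩
  -- A face of a face is a face, so an extreme point of the `ψ`-maximal part of `F` is extreme in
  -- `s`.
  have hG : IsExposed ℝ F {y ∈ F | ∀ z ∈ F, ψ z ≤ ψ y} := fun _ => ⟨ψ, rfl⟩
  have hFc := hF.isCompact hs
  obtain ⟨z, hzF, hz⟩ := hFc.exists_isMaxOn ⟨v, hvF⟩ ψ.continuous.continuousOn
  obtain ⟨e, he⟩ := (hG.isCompact hFc).extremePoints_nonempty ⟨z, hzF, hz⟩
  exact ⟨e, hF.isExtreme.extremePoints_subset_extremePoints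
      (hG.isExtreme.extremePoints_subset_extremePoints he),
    le_antisymm (hmax e he.1.1.1) (he.1.1.2 v hv), he.1.2 v hvF⟩

section Spaces

variable {X Y : Type*} [NormedAddCommGroup X] [NormedSpace ℝ X]
  [NormedAddCommGroup Y] [NormedSpace ℝ Y]

/-! ### Weak and weak-star compactness -/

theorem t2Space_weakSpace : T2Space (WeakSpace ℝ X) :=
  (NormedSpace.isEmbedding_inclusionInDoubleDualWeak ℝ X).t2Space

/-- The closed unit ball of a reflexive space is weakly compact. -/
theorem IsReflexive.isCompact_closedBall (hX : IsReflexive X) :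
    IsCompact (toWeakSpace ℝ X '' Metric.closedBall (0 : X) 1) := by
  have hpre : toWeakSpace ℝ X '' Metric.closedBall (0 : X) 1 =
      NormedSpace.inclusionInDoubleDualWeak ℝ X ⁻¹'
        (WeakDual.toStrongDual ⁻¹'
          Metric.closedBall (0 : StrongDual ℝ (StrongDual ℝ X)) 1) := by
    ext w
    obtain ⟨w, rfl⟩ := (toWeakSpace ℝ X).surjective w
    have : ‖NormedSpace.inclusionInDoubleDual ℝ X w‖ = ‖w‖ :=
      (NormedSpace.inclusionInDoubleDualLi (E := X) ℝ).norm_map w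
    rw [(toWeakSpace ℝ X).injective.mem_set_image]
    simp only [mem_preimage, mem_closedBall_zero_iff]
    rw [← this]
    rfl
  rw [hpre]
  refine (NormedSpace.isEmbedding_inclusionInDoubleDualWeak ℝ X).isCompact_preimage'
    (WeakDual.isCompact_closedBall _ _) ?_
  -- Reflexivity enters here: the bidual ball lies in the range of the embedding.
  intro u _
  obtain ⟨w, hw⟩ := hX (WeakDual.toStrongDual u)
  exact ⟨toWeakSpace ℝ X w, hw⟩

/-- In a reflexive space, lexicographic maximisation of two functionals over the unit ball is
realised at an extreme point. -/
theorem IsReflexive.exists_extremeBall (hX : IsReflexive X) (φ ψ : StrongDual ℝ X) {v : X}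
    (hv : ‖v‖ ≤ 1) (hmax : ∀ w, ‖w‖ ≤ 1 → φ w ≤ φ v) :
    ∃ e ∈ extremeBall X, φ e = φ v ∧ ψ v ≤ ψ e := by
  have := t2Space_weakSpace (X := X)
  have hcont (f : StrongDual ℝ X) : Continuous fun w : WeakSpace ℝ X =>
      f ((toWeakSpace ℝ X).symm w) :=
    WeakBilin.eval_continuous (topDualPairing ℝ X).flip f
  let lift (f : StrongDual ℝ X) : StrongDual ℝ (WeakSpace ℝ X) :=
    ⟨f.toLinearMap ∘ₗ (toWeakSpace ℝ X).symm.toLinearMap, hcont f⟩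
  have : LocallyConvexSpace ℝ (WeakSpace ℝ X) :=
    inferInstanceAs (LocallyConvexSpace ℝ (WeakBilin (topDualPairing ℝ X).flip))
  obtain ⟨e, he, h1, h2⟩ := exists_extremePoint_of_isMaxOn hX.isCompact_closedBall
    (lift φ) (lift ψ) (v := toWeakSpace ℝ X v) (mem_image_of_mem _ (by simpa using hv)) (by
      rintro _ ⟨w, hw, rfl⟩
      exact hmax w (by simpa using hw))
  rw [← image_extremePoints] at he
  obtain ⟨e, he, rfl⟩ := he
  exact ⟨e, he, h1, h2⟩

/-- Bounded ultrafilters in a reflexive space converge weakly. -/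
theorem IsReflexive.exists_weak_limit (hX : IsReflexive X) {ι : Type*} (U : Ultrafilter ι)
    (v : ι → X) (hv : ∀ k, ‖v k‖ ≤ 1) :
    ∃ a : X, ‖a‖ ≤ 1 ∧ ∀ f : StrongDual ℝ X, Tendsto (fun k => f (v k)) U (𝓝 (f a)) := by
  obtain ⟨_, ⟨a, ha, rfl⟩, h⟩ := hX.isCompact_closedBall.ultrafilter_le_nhds
    (U.map fun k => toWeakSpace ℝ X (v k)) (by
      rw [le_principal_iff, Ultrafilter.coe_map, mem_map]
      exact Eventually.of_forall fun k => mem_image_of_mem _ (by simpa using hv k))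
  refine ⟨a, by simpa using ha, fun f => ?_⟩
  exact ((WeakBilin.eval_continuous (topDualPairing ℝ X).flip f).tendsto _).comp h

/-- Bounded ultrafilters in a dual space converge in the weak-star topology. -/
theorem exists_weakStar_limit {ι : Type*} (U : Ultrafilter ι)
    (g : ι → StrongDual ℝ Y) (hg : ∀ k, ‖g k‖ ≤ 1) :
    ∃ b : StrongDual ℝ Y, ‖b‖ ≤ 1 ∧ ∀ y, Tendsto (fun k => g k y) U (𝓝 (b y)) := by
  obtain ⟨b, hb, h⟩ :=
    (WeakDual.isCompact_closedBall (0 : StrongDual ℝ Y) 1).ultrafilter_le_nhds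
    (U.map fun k => StrongDual.toWeakDual (g k)) (by
      rw [le_principal_iff, Ultrafilter.coe_map, mem_map]
      exact Eventually.of_forall fun k => by simpa using hg k)
  refine ⟨WeakDual.toStrongDual b, by simpa using hb, fun y => ?_⟩
  exact ((WeakDual.eval_continuous y).tendsto b).comp h

/-- A compact operator maps bounded weakly convergent ultrafilters to norm convergent ones. -/
theorem tendsto_of_isCompactOperator {T : X →L[ℝ] Y} (hT : IsCompactOperator T) {ι : Type*}
    (U : Ultrafilter ι) {v : ι → X} (hv : ∀ k, ‖v k‖ ≤ 1) {a : X}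
    (h : ∀ f : StrongDual ℝ X, Tendsto (fun k => f (v k)) U (𝓝 (f a))) :
    Tendsto (fun k => T (v k)) U (𝓝 (T a)) := by
  obtain ⟨K, hK, hTK⟩ := hT.image_closedBall_subset_compact 1
  obtain ⟨y, -, hy⟩ := hK.ultrafilter_le_nhds (U.map fun k => T (v k)) (by
    rw [le_principal_iff, Ultrafilter.coe_map, mem_map]
    exact Eventually.of_forall fun k => hTK (mem_image_of_mem _ (by simpa using hv k)))
  have hy' : Tendsto (fun k => T (v k)) U (𝓝 y) := hy
  suffices y = T a by rwa [← this]
  refine (SeparatingDual.eq_iff_forall_dual_eq (R := ℝ)).2 fun f => ?_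
  exact tendsto_nhds_unique ((f.continuous.tendsto y).comp hy') (h (f.comp T))

/-- The duality pairing is jointly continuous along bounded weak-star convergent functionals and
norm convergent vectors. -/
theorem tendsto_apply_of_weakStar {ι : Type*} {l : Filter ι} {g : ι → StrongDual ℝ Y}
    (hg : ∀ k, ‖g k‖ ≤ 1) {b : StrongDual ℝ Y} (hb : ∀ y, Tendsto (fun k => g k y) l (𝓝 (b y)))
    {w : ι → Y} {y : Y} (hw : Tendsto w l (𝓝 y)) :
    Tendsto (fun k => g k (w k)) l (𝓝 (b y)) := by
  have h0 : Tendsto (fun k => g k (w k - y)) l (𝓝 0) := by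
    refine squeeze_zero_norm (fun k => ?_) (tendsto_iff_norm_sub_tendsto_zero.1 hw)
    exact (g k).le_of_opNorm_le (hg k) _ |>.trans_eq (one_mul _)
  simpa using h0.add (hb y)

/-! ### Finding the norm-attaining extreme point -/

/-- Finitely many linearly independent vectors can be sent to prescribed vectors of a subspace `Z`
by a compact operator with values in `Z`. -/
theorem exists_compact_operatorsInto_apply_eq {n : ℕ} {x : Fin n → X}
    (hx : LinearIndependent ℝ x) (Z : Submodule ℝ Y) (z : Fin n → Y) (hz : ∀ i, z i ∈ Z) :
    ∃ S ∈ operatorsInto X Z, IsCompactOperator S ∧ ∀ i, S (x i) = z i := by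
  have hdual : ∀ i, ∃ f : StrongDual ℝ X, ∀ j, f (x j) = if i = j then 1 else 0 := by
    intro i
    have : FiniteDimensional ℝ (Submodule.span ℝ (range x)) :=
      FiniteDimensional.span_of_finite ℝ (finite_range x)
    obtain ⟨f, hf, -⟩ := exists_extension_norm_eq (Submodule.span ℝ (range x))
      (LinearMap.toContinuousLinearMap ((Module.Basis.span hx).coord i))
    refine ⟨f, fun j => ?_⟩
    have hmem : x j ∈ Submodule.span ℝ (range x) := Submodule.subset_span (mem_range_self j)
    have hj : Module.Basis.span hx j = ⟨x j, hmem⟩ := Module.Basis.span_apply hx j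
    have := hf ⟨x j, hmem⟩
    rw [this, ← hj]
    simp [Finsupp.single_apply, eq_comm]
  choose f hf using hdual
  have happ (u : X) : (∑ i, (f i).smulRight (z i)) u = ∑ i, f i u • z i := by simp
  refine ⟨∑ i, (f i).smulRight (z i), fun u => ?_, ?_, fun j => ?_⟩
  · rw [happ]
    exact Z.sum_mem fun i _ => Z.smul_mem _ (hz i)
  · refine Submodule.sum_mem (compactOperator (RingHom.id ℝ) X Y) fun i _ => ?_
    have : IsCompactOperator (f i) :=
      (isCompactOperator_id (E := ℝ)).comp_clm (f i)
    exact this.clm_comp ((1 : ℝ →L[ℝ] ℝ).smulRight (z i))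
  · rw [happ]
    simp [hf]

/-- If `T` is orthogonal to `S` with `T`, `S` compact and `X` reflexive, then `T` attains its norm
at some `a`, with a functional `b` norming `T a` that is nonnegative at `S a`. -/
theorem exists_norming_of_bjOrth (hX : IsReflexive X) {T S : X →L[ℝ] Y}
    (hT : IsCompactOperator T) (hS : IsCompactOperator S) (hTS : BJOrth T S) :
    ∃ a : X, ∃ b : StrongDual ℝ Y, ‖a‖ ≤ 1 ∧ ‖b‖ ≤ 1 ∧ b (T a) = ‖T‖ ∧ 0 ≤ b (S a) := by
  have key : ∀ k : ℕ, ∃ a : X, ∃ b : StrongDual ℝ Y, ‖a‖ ≤ 1 ∧ ‖b‖ ≤ 1 ∧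
      ‖T‖ - (1 / ((k : ℝ) + 1)) ^ 2 ≤ b (T a) + 1 / ((k : ℝ) + 1) * b (S a) := by
    intro k
    set t : ℝ := 1 / ((k : ℝ) + 1)
    have ht : 0 < t := by positivity
    -- The slack `t ^ 2` is chosen to vanish even after division by `t`.
    obtain ⟨a, ha, hlt⟩ := (T + t • S).exists_lt_apply_of_lt_opNorm
      (r := ‖T‖ - t ^ 2) (by nlinarith [hTS t])
    obtain ⟨b, hb, hba⟩ := exists_dual_vector'' ℝ ((T + t • S) a)
    refine ⟨a, b, ha.le, hb, ?_⟩
    have : b ((T + t • S) a) = b (T a) + t * b (S a) := by simp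
    rw [← this, hba]
    exact hlt.le
  choose v g hv hg hk using key
  let U : Ultrafilter ℕ := hyperfilter ℕ
  obtain ⟨a, ha, hva⟩ := hX.exists_weak_limit U v hv
  obtain ⟨b, hb, hgb⟩ := exists_weakStar_limit U g hg
  have hTlim := tendsto_apply_of_weakStar hg hgb (tendsto_of_isCompactOperator hT U hv hva)
  have hSlim := tendsto_apply_of_weakStar hg hgb (tendsto_of_isCompactOperator hS U hv hva)
  have htlim : Tendsto (fun k : ℕ => 1 / ((k : ℝ) + 1)) U (𝓝 0) :=
    tendsto_one_div_add_atTop_nhds_zero_nat.mono_left Nat.hyperfilter_le_atTop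
  have hle (b : StrongDual ℝ Y) (hb : ‖b‖ ≤ 1) (a : X) (ha : ‖a‖ ≤ 1) : b (T a) ≤ ‖T‖ :=
    calc b (T a) ≤ ‖b (T a)‖ := le_abs_self _
      _ ≤ 1 * ‖T a‖ := b.le_of_opNorm_le hb _
      _ ≤ ‖T‖ := by rw [one_mul]; exact T.unit_le_opNorm a ha
  refine ⟨a, b, ha, hb, le_antisymm (hle b hb a ha) ?_, ?_⟩
  · have h1 := (tendsto_const_nhds (x := ‖T‖)).sub (htlim.pow 2)
    have h2 := hTlim.add (htlim.mul hSlim)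
    simpa using le_of_tendsto_of_tendsto' h1 h2 hk
  · have h0 := htlim.neg
    rw [neg_zero] at h0
    refine le_of_tendsto_of_tendsto' h0 hSlim fun k => ?_
    -- As `g k (T (v k)) ≤ ‖T‖`, the inequality `hk` divided by `t = 1 / (k + 1)` leaves `-t ≤ g k
    -- (S (v k))`.
    have ht : (0 : ℝ) < 1 / ((k : ℝ) + 1) := by positivity
    have := hk k
    have := hle _ (hg k) _ (hv k)
    nlinarith

/-- A compact operator on a reflexive space that is orthogonal to `ℒ(X, Z)` has a norm-attaining
extreme point whose image is orthogonal to `Z`, if its norm-attaining extreme points are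
`± x i` for linearly independent `x i`. -/
theorem exists_bjOrthTo_apply (hX : IsReflexive X) (Z : Submodule ℝ Y) {T : X →L[ℝ] Y}
    (hT : IsCompactOperator T) (hT0 : T ≠ 0) {n : ℕ} {x : Fin n → X}
    (hx : LinearIndependent ℝ x)
    (hM : normAttainment T ∩ extremeBall X = {v | ∃ i, v = x i ∨ v = -x i})
    (hTZ : BJOrthTo T (operatorsInto X Z)) :
    ∃ x₀ ∈ normAttainment T ∩ extremeBall X, BJOrthTo (T x₀) Z := by
  have hxM (i : Fin n) : x i ∈ normAttainment T ∩ extremeBall X := by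
    rw [hM]
    exact ⟨i, Or.inl rfl⟩
  by_contra! hcon
  have hz : ∀ i, ∃ z ∈ Z, ‖T (x i) + z‖ < ‖T‖ := by
    intro i
    have h := hcon (x i) (hxM i)
    simp only [BJOrthTo, BJOrth, not_forall, not_le] at h
    obtain ⟨w, hw, c, hc⟩ := h
    exact ⟨c • w, Z.smul_mem c hw, hc.trans_eq (hxM i).1.2⟩
  choose z hzZ hz using hz
  obtain ⟨S, hSZ, hS, hSx⟩ := exists_compact_operatorsInto_apply_eq hx Z z hzZ
  obtain ⟨a, b, ha, hb, hba, hbS⟩ := exists_norming_of_bjOrth hX hT hS (hTZ S hSZ)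
  have hbound (y : Y) : b y ≤ ‖y‖ :=
    (le_abs_self _).trans ((b.le_of_opNorm_le hb y).trans_eq (one_mul _))
  obtain ⟨e, he, heT, heS⟩ := hX.exists_extremeBall (b.comp T) (b.comp S) ha (by
    intro w hw
    simp only [ContinuousLinearMap.comp_apply, hba]
    exact (hbound _).trans (T.unit_le_opNorm w hw))
  simp only [ContinuousLinearMap.comp_apply, hba] at heT heS
  have he1 : ‖e‖ ≤ 1 := by simpa using he.1
  have hTe : ‖T e‖ = ‖T‖ :=
    le_antisymm (T.unit_le_opNorm e he1) (heT.symm.trans_le (hbound _))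
  have heN : ‖e‖ = 1 := by
    refine le_antisymm he1 ?_
    have h := T.le_opNorm e
    rw [hTe] at h
    exact (le_mul_iff_one_le_right (norm_pos_iff.2 hT0)).1 h
  have hmem : e ∈ normAttainment T ∩ extremeBall X := ⟨⟨heN, hTe⟩, he⟩
  rw [hM] at hmem
  -- In either case `b (T e + S e) ≥ ‖T‖`, while `T e + S e = ± (T (x i) + z i)` has norm below
  -- `‖T‖`.
  obtain ⟨i, rfl | rfl⟩ := hmem
  · have h := (hbound _).trans_lt (hz i)
    rw [map_add, heT] at h
    rw [hSx] at heS
    linarith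
  · have h := (hbound (-(T (x i) + z i))).trans_lt ((norm_neg _).trans_lt (hz i))
    rw [map_neg, map_neg] at heT heS
    rw [map_neg, map_add] at h
    rw [hSx] at heS
    linarith

/-! ### Orthogonality, distance and the biannihilator -/

/-- Orthogonality to a subspace says that the distance to it equals the norm. -/
theorem BJOrthTo.infDist_eq {y : Y} {W : Submodule ℝ Y} (h : BJOrthTo y W) :
    Metric.infDist y (W : Set Y) = ‖y‖ := by
  refine le_antisymm ?_ ((Metric.le_infDist ⟨0, W.zero_mem⟩).2 fun w hw => ?_)
  · simpa using Metric.infDist_le_dist_of_mem (x := y) W.zero_mem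
  · simpa [dist_eq_norm, sub_eq_add_neg] using h w hw (-1)

/-- A vector orthogonal to a closed subspace is normed by a functional in the annihilator. -/
theorem BJOrthTo.exists_annihilator {y : Y} {W : Submodule ℝ Y} (hW : IsClosed (W : Set Y))
    (h : BJOrthTo y W) : ∃ f ∈ annihilator W, ‖f‖ ≤ 1 ∧ f y = ‖y‖ := by
  have : IsClosed (W : Set Y) := hW
  -- The quotient norm of `y` is its distance to `W`, which orthogonality makes equal to `‖y‖`; so
  -- `g` pulls back to a functional norming `y`.
  obtain ⟨g, hg, hgy⟩ := exists_dual_vector'' ℝ (W.mkQ y)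
  have hnorm (u : Y) : ‖W.mkQL u‖ ≤ 1 * ‖u‖ := by
    rw [one_mul]
    exact Submodule.Quotient.norm_mk_le W u
  refine ⟨g.comp W.mkQL, fun w hw => ?_, ?_, ?_⟩
  · have : W.mkQL w = 0 := (Submodule.Quotient.mk_eq_zero W).2 hw
    simp [this]
  · refine (g.opNorm_comp_le _).trans ?_
    exact mul_le_one₀ hg (norm_nonneg _) (ContinuousLinearMap.opNorm_le_bound _ zero_le_one hnorm)
  · have hd : ‖W.mkQ y‖ = Metric.infDist y (W : Set Y) :=
      QuotientAddGroup.norm_mk (S := W.toAddSubgroup) y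
    rw [← h.infDist_eq, ← hd]
    exact hgy

/-- Orthogonality to a closed subspace passes to its biannihilator. -/
theorem BJOrthTo.inclusionInDoubleDual {y : Y} {W : Submodule ℝ Y} (hW : IsClosed (W : Set Y))
    (h : BJOrthTo y W) :
    BJOrthTo (NormedSpace.inclusionInDoubleDual ℝ Y y) (biannihilator W) := by
  obtain ⟨f, hfW, hf, hfy⟩ := h.exists_annihilator hW
  intro u hu c
  set ι := NormedSpace.inclusionInDoubleDual ℝ Y
  have huf : u f = 0 := hu f hfW
  calc ‖ι y‖ ≤ ‖y‖ := NormedSpace.double_dual_bound ℝ Y y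
    _ = (ι y + c • u) f := by
      rw [← hfy]
      simp [ι, huf]
    _ ≤ ‖(ι y + c • u) f‖ := le_abs_self _
    _ ≤ ‖ι y + c • u‖ := (ι y + c • u).unit_le_opNorm f hf

/-- Orthogonality at a norm-attaining vector gives orthogonality of operators. -/
theorem BJOrthTo.of_apply {T : X →L[ℝ] Y} {W : Submodule ℝ Y} {a : X} (ha : ‖a‖ ≤ 1)
    (hTa : ‖T‖ ≤ ‖T a‖) (h : BJOrthTo (T a) W) : BJOrthTo T (operatorsInto X W) := by
  intro S hS c
  exact hTa.trans ((h (S a) (hS a) c).trans ((T + c • S).unit_le_opNorm a ha))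

end Spaces

end BJMinimax

theorem theorem2p8 {X Y : Type*}
    [NormedAddCommGroup X] [NormedSpace ℝ X] [CompleteSpace X]
    [NormedAddCommGroup Y] [NormedSpace ℝ Y] [CompleteSpace Y]
    (hX : BJMinimax.IsReflexive X)
    (Z : Submodule ℝ Y) (hZ : IsClosed (Z : Set Y))
    (T : X →L[ℝ] Y) (hT : IsCompactOperator T) (hsmooth : BJMinimax.IsMultiSmooth T)
    (n : ℕ) (x : Fin n → X) (hx : LinearIndependent ℝ x)
    (hM : BJMinimax.normAttainment T ∩ BJMinimax.extremeBall X =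
      {v | ∃ i, v = x i ∨ v = -x i})
    (hTZ : BJMinimax.BJOrthTo T (BJMinimax.operatorsInto X Z)) :
    ∃ x₀ ∈ BJMinimax.normAttainment T ∩ BJMinimax.extremeBall X,
      (IsLUB ((fun u => Metric.infDist (T u) (Z : Set Y)) '' Metric.sphere (0 : X) 1)
          (Metric.infDist T (BJMinimax.operatorsInto X Z : Set (X →L[ℝ] Y))) ∧
        Metric.infDist T (BJMinimax.operatorsInto X Z : Set (X →L[ℝ] Y)) =
          Metric.infDist (T x₀) (Z : Set Y)) ∧
      BJMinimax.BJOrthTo (NormedSpace.inclusionInDoubleDual ℝ Y (T x₀))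
        (BJMinimax.biannihilator Z) ∧
      BJMinimax.BJOrthTo (BJMinimax.toBidual T)
        (BJMinimax.operatorsInto X (BJMinimax.biannihilator Z)) := by
  obtain ⟨x₀, hx₀, horth⟩ :=
    BJMinimax.exists_bjOrthTo_apply hX Z hT hsmooth.1 hx hM hTZ
  have hbi := horth.inclusionInDoubleDual hZ
  refine ⟨x₀, hx₀, ⟨?_, ?_⟩, hbi, hbi.of_apply (T := BJMinimax.toBidual T) hx₀.1.1.le ?_⟩
  · rw [hTZ.infDist_eq]
    refine IsGreatest.isLUB ⟨⟨x₀, by simpa using hx₀.1.1, ?_⟩, ?_⟩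
    · exact horth.infDist_eq.trans hx₀.1.2
    · rintro _ ⟨u, hu, rfl⟩
      -- Comparing with `0 ∈ Z` bounds every distance by `‖T u‖ ≤ ‖T‖`, the value reached at `x₀`.
      have hd := Metric.infDist_le_dist_of_mem (x := T u) Z.zero_mem
      rw [dist_zero_right] at hd
      exact hd.trans (T.unit_le_opNorm u (by simpa using (mem_sphere_zero_iff_norm.1 hu).le))
  · rw [hTZ.infDist_eq, horth.infDist_eq, hx₀.1.2]
  · have hnorm (y : Y) : ‖NormedSpace.inclusionInDoubleDual ℝ Y y‖ = ‖y‖ :=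
      (NormedSpace.inclusionInDoubleDualLi (E := Y) ℝ).norm_map y
    rw [show ‖BJMinimax.toBidual T x₀‖ = ‖T‖ from (hnorm _).trans hx₀.1.2]
    refine ContinuousLinearMap.opNorm_le_bound _ (norm_nonneg _) fun u => ?_
    exact (hnorm (T u)).trans_le (T.le_opNorm u)
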